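/- Let $\mathcal A$ be a unital complex algebra with a linear functional $\varphi:\mathcal A\to\mathbb C$, $\varphi(1_{\mathcal A})=1$. Let $\mathcal F$ be a (not necessarily unital) complex algebra that is an $\mathcal A$-algebra, i.e. it has a unital $\mathcal A$-bimodule structure over $\mathbb C$ with $(af)g=a(fg)$, $(fa)g=f(ag)$, $f(ga)=(fg)a$ for $a\in\mathcal A$, $f,g\in\mathcal F$, and let $\Phi:\mathcal F\to\mathbb C$ be a linear functional. (Such a tuple $(\mathcal A,\varphi,\mathcal F,\Phi)$ is called a noncommutative probability space of type B$'$.) Let $\mathcal B=\mathcal A\oplus\mathcal F$ be the unital algebra with multiplication $(a_1,f_1)(a_2,f_2)=(a_1a_2,\;a_1f_2+f_1a_2+f_1f_2)$ and unit $(1_{\mathcal A},0)$, and define linear functionals on $\mathcal B$ by $\varphi(a,f):=\varphi(a)$ and $\varphi'(a,f):=\Phi(f)$; $(\mathcal B,\varphi,\varphi')$ is the associated infinitesimal noncommutative probability space. Let $\mathcal A_1\subseteq\mathcal A$ be a subalgebra containing $1_{\mathcal A}$ and $\mathcal F_1\subseteq\mathcal F$ a subalgebra. The pair $(\mathcal A_1,\mathcal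 F_1)$ is called cyclic-antimonotone independent if for all $n\ge1$, $a_0,\dots,a_n\in\mathcal A_1$ and $f_1,\dots,f_n\in\mathcal F_1$ $$\Phi(a_0f_1a_1f_2\cdots a_{n-1}f_na_n)=\varphi(a_0a_n)\Big[\prod_{i=1}^{n-1}\varphi(a_i)\Big]\Phi(f_1f_2\cdots f_n).$$ Subalgebras $(\mathcal B_i)_{i\in I}$ of $\mathcal B$ containing its unit are called infinitesimally free if for all $n\ge1$, all $i_1,\dots,i_n\in I$ with $i_k\ne i_{k+1}$ for $1\le k\le n-1$, and all $b_k\in\mathcal B_{i_k}$ with $\varphi(b_k)=0$, one has $\varphi(b_1\cdots b_n)=0$ and $$\varphi'(b_1\cdots b_n)=\Big[\prod_{k=1}^{(n-1)/2}\varphi(b_kb_{n+1-k})\Big]\varphi'(b_{(n+1)/2})$$ if $n$ is odd and $i_k=i_{n+1-k}$ for all $1\le k\le (n-1)/2$, while $\varphi'(b_1\cdots b_n)=0$ otherwise. **Proposition.** The pair $(\mathcal A_1,\mathcal F_1)$ is cyclic-antimonotone independent if and only if the two subalgebras $\mathcal A_1':=\mathcal A_1\oplus\{0_{\mathcal F}\}$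 and $\mathcal F_1':=\mathbb C1_{\mathcal A}\oplus\mathcal F_1$ are infinitesimally free in $(\mathcal B,\varphi,\varphi')$. -/

import Mathlib

open scoped RightActions

/-- `F` is an `A`-algebra: a (not necessarily unital) complex algebra with an `A`-bimodule structure
(left action `a • f`, right action `f <• a`) that is consistent with the multiplication of `F` and
with the scalar multiplication by complex numbers. -/
class IsBimoduleAlgebra (A F : Type*) [Ring A] [Algebra ℂ A] [NonUnitalRing F] [Module ℂ F]
    [Module A F] [Module Aᵐᵒᵖ F] : Prop where
  smul_rsmul : ∀ (a b : A) (f : F), (a • f) <• b = a • (f <• b)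
  smul_mul : ∀ (a : A) (f g : F), (a • f) * g = a • (f * g)
  mul_rsmul : ∀ (a : A) (f g : F), f * (g <• a) = (f * g) <• a
  rsmul_mul : ∀ (a : A) (f g : F), (f <• a) * g = f * (a • g)
  algebraMap_smul : ∀ (c : ℂ) (f : F), algebraMap ℂ A c • f = c • f
  algebraMap_rsmul : ∀ (c : ℂ) (f : F), f <• algebraMap ℂ A c = c • f

/-- A noncommutative probability space of type B′ `(A, φ, F, Φ)` on the unital algebra `A` and the
`A`-algebra `F`. -/
structure NCPSTypeBPrime (A F : Type*) [Ring A] [Algebra ℂ A] [NonUnitalRing F] [Module ℂ F]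
    [IsScalarTower ℂ F F] [SMulCommClass ℂ F F] [Module A F] [Module Aᵐᵒᵖ F]
    [IsBimoduleAlgebra A F] where
  /-- the unital linear functional on `A` -/
  φ : A →ₗ[ℂ] ℂ
  φ_one : φ 1 = 1
  /-- the linear functional on `F` -/
  Φ : F →ₗ[ℂ] ℂ

/-- An infinitesimal noncommutative probability space `(B, φ, φ')`. -/
structure InfinitesimalNCPS (B : Type*) [Ring B] [Algebra ℂ B] where
  /-- the unital linear functional -/
  φ : B →ₗ[ℂ] ℂ
  φ_one : φ 1 = 1
  /-- the infinitesimal functional -/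
  φ' : B →ₗ[ℂ] ℂ
  φ'_one : φ' 1 = 0

/-- Infinitesimal freeness of a family of unital subalgebras. The positions `1, …, n` are numbered
`0, …, n - 1`, so that the mirror image of position `k` is `k.rev = n - 1 - k`, and for odd `n` the
middle position is `n / 2`. -/
def InfinitesimallyFree {B : Type*} [Ring B] [Algebra ℂ B] (P : InfinitesimalNCPS B)
    {I : Type*} (S : I → Subalgebra ℂ B) : Prop :=
  ∀ (n : ℕ) (hn : 0 < n) (i : Fin n → I) (b : Fin n → B),
    (∀ k l : Fin n, (k : ℕ) + 1 = l → i k ≠ i l) →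
    (∀ k, b k ∈ S (i k) ∧ P.φ (b k) = 0) →
    P.φ (List.ofFn b).prod = 0 ∧
    (Odd n ∧ (∀ k, i k = i k.rev) →
      P.φ' (List.ofFn b).prod =
        (∏ k : Fin (n / 2), P.φ (b (k.castLE (Nat.div_le_self n 2)) *
          b (k.castLE (Nat.div_le_self n 2)).rev)) *
          P.φ' (b ⟨n / 2, Nat.div_lt_self hn one_lt_two⟩)) ∧
    (¬ (Odd n ∧ (∀ k, i k = i k.rev)) → P.φ' (List.ofFn b).prod = 0)

/-- The product `x 0 * x 1 * ⋯ * x n` of `n + 1` elements of a possibly non-unital algebra. -/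
def prodSucc {F : Type*} [Mul F] : (n : ℕ) → (Fin (n + 1) → F) → F
  | 0, x => x 0
  | n + 1, x => prodSucc n (fun k => x k.castSucc) * x (Fin.last (n + 1))

/-- The algebra `A ⊕ F` of formal sums of a main term in `A` and a perturbation term in `F`. -/
@[ext]
structure PertAlg (A F : Type*) where
  /-- the main term -/
  main : A
  /-- the perturbation term -/
  pert : F

set_option linter.unusedSectionVars false

namespace PertAlg

section
variable {A F : Type*} [Ring A] [Algebra ℂ A] [NonUnitalRing F] [Module ℂ F]
  [Module A F] [Module Aᵐᵒᵖ F]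

instance : Zero (PertAlg A F) := ⟨⟨0, 0⟩⟩
instance : One (PertAlg A F) := ⟨⟨1, 0⟩⟩
instance : Add (PertAlg A F) := ⟨fun x y => ⟨x.main + y.main, x.pert + y.pert⟩⟩
instance : Neg (PertAlg A F) := ⟨fun x => ⟨-x.main, -x.pert⟩⟩
instance : SMul ℂ (PertAlg A F) := ⟨fun c x => ⟨c • x.main, c • x.pert⟩⟩
instance : Mul (PertAlg A F) :=
  ⟨fun x y => ⟨x.main * y.main, x.main • y.pert + x.pert <• y.main + x.pert * y.pert⟩⟩

@[simp] theorem zero_main : (0 : PertAlg A F).main = 0 := rfl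
@[simp] theorem zero_pert : (0 : PertAlg A F).pert = 0 := rfl
@[simp] theorem one_main : (1 : PertAlg A F).main = 1 := rfl
@[simp] theorem one_pert : (1 : PertAlg A F).pert = 0 := rfl
@[simp] theorem add_main (x y : PertAlg A F) : (x + y).main = x.main + y.main := rfl
@[simp] theorem add_pert (x y : PertAlg A F) : (x + y).pert = x.pert + y.pert := rfl
@[simp] theorem neg_main (x : PertAlg A F) : (-x).main = -x.main := rfl
@[simp] theorem neg_pert (x : PertAlg A F) : (-x).pert = -x.pert := rfl
@[simp] theorem smul_main (c : ℂ) (x : PertAlg A F) : (c • x).main = c • x.main := rfl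
@[simp] theorem smul_pert (c : ℂ) (x : PertAlg A F) : (c • x).pert = c • x.pert := rfl
@[simp] theorem mul_main (x y : PertAlg A F) : (x * y).main = x.main * y.main := rfl
@[simp] theorem mul_pert (x y : PertAlg A F) :
    (x * y).pert = x.main • y.pert + x.pert <• y.main + x.pert * y.pert := rfl

variable [IsBimoduleAlgebra A F]

instance : Ring (PertAlg A F) where
  add_assoc _ _ _ := by ext <;> simp [add_assoc]
  zero_add _ := by ext <;> simp
  add_zero _ := by ext <;> simp
  add_comm _ _ := by ext <;> simp [add_comm]
  neg_add_cancel _ := by ext <;> simp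
  nsmul := nsmulRec
  zsmul := zsmulRec
  left_distrib x y z := by
    ext
    · simp [mul_add]
    · simp only [mul_pert, add_main, add_pert, smul_add, mul_add, MulOpposite.op_add, add_smul]
      abel
  right_distrib x y z := by
    ext
    · simp [add_mul]
    · simp only [mul_pert, add_main, add_pert, smul_add, add_mul, add_smul]
      abel
  zero_mul _ := by ext <;> simp
  mul_zero _ := by ext <;> simp
  one_mul _ := by ext <;> simp
  mul_one _ := by ext <;> simp
  mul_assoc x y z := by
    ext
    · simp [mul_assoc]
    · simp only [mul_pert, mul_main, smul_add, add_mul, mul_add, MulOpposite.op_mul, mul_smul,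
        IsBimoduleAlgebra.smul_rsmul, IsBimoduleAlgebra.smul_mul, IsBimoduleAlgebra.mul_rsmul,
        IsBimoduleAlgebra.rsmul_mul, mul_assoc]
      abel

instance : Algebra ℂ (PertAlg A F) where
  algebraMap :=
    { toFun := fun c => ⟨algebraMap ℂ A c, 0⟩
      map_one' := by ext <;> simp
      map_zero' := by ext <;> simp
      map_add' := fun _ _ => by ext <;> simp
      map_mul' := fun _ _ => by ext <;> simp }
  commutes' c x := by
    ext
    · exact Algebra.commutes c x.main
    · simp [IsBimoduleAlgebra.algebraMap_smul, IsBimoduleAlgebra.algebraMap_rsmul]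
  smul_def' c x := by
    ext
    · exact Algebra.smul_def c x.main
    · simp [IsBimoduleAlgebra.algebraMap_smul]

@[simp] theorem algebraMap_main (c : ℂ) :
    (algebraMap ℂ (PertAlg A F) c).main = algebraMap ℂ A c := rfl
@[simp] theorem algebraMap_pert (c : ℂ) : (algebraMap ℂ (PertAlg A F) c).pert = 0 := rfl

/-- The subalgebra `A₁ ⊕ {0}`. -/
def ofMain (A₁ : Subalgebra ℂ A) : Subalgebra ℂ (PertAlg A F) where
  carrier := {b | b.main ∈ A₁ ∧ b.pert = 0}
  mul_mem' {x y} hx hy := ⟨A₁.mul_mem hx.1 hy.1, by simp [hx.2, hy.2]⟩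
  add_mem' {x y} hx hy := ⟨A₁.add_mem hx.1 hy.1, by simp [hx.2, hy.2]⟩
  algebraMap_mem' c := ⟨A₁.algebraMap_mem c, rfl⟩

/-- The subalgebra `ℂ1 ⊕ F₁`. -/
def ofPert (F₁ : NonUnitalSubalgebra ℂ F) : Subalgebra ℂ (PertAlg A F) where
  carrier := {b | (∃ c : ℂ, b.main = algebraMap ℂ A c) ∧ b.pert ∈ F₁}
  mul_mem' {x y} := by
    rintro ⟨⟨c, hc⟩, hx⟩ ⟨⟨d, hd⟩, hy⟩
    refine ⟨⟨c * d, by simp [hc, hd]⟩, ?_⟩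
    rw [mul_pert, hc, hd, IsBimoduleAlgebra.algebraMap_smul, IsBimoduleAlgebra.algebraMap_rsmul]
    exact F₁.add_mem (F₁.add_mem (F₁.smul_mem c hy) (F₁.smul_mem d hx)) (F₁.mul_mem hx hy)
  add_mem' {x y} := by
    rintro ⟨⟨c, hc⟩, hx⟩ ⟨⟨d, hd⟩, hy⟩
    exact ⟨⟨c + d, by simp [hc, hd]⟩, F₁.add_mem hx hy⟩
  algebraMap_mem' c := ⟨⟨c, rfl⟩, F₁.zero_mem⟩

end

end PertAlg

namespace NCPSTypeBPrime

section
variable {A F : Type*} [Ring A] [Algebra ℂ A] [NonUnitalRing F] [Module ℂ F]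
  [IsScalarTower ℂ F F] [SMulCommClass ℂ F F] [Module A F] [Module Aᵐᵒᵖ F]
  [IsBimoduleAlgebra A F]

/-- The infinitesimal noncommutative probability space `(A ⊕ F, φ, φ')` associated with
`(A, φ, F, Φ)`: `φ (a + f) = φ a` and `φ' (a + f) = Φ f`. -/
def toInfinitesimal (P : NCPSTypeBPrime A F) : InfinitesimalNCPS (PertAlg A F) where
  φ :=
    { toFun := fun b => P.φ b.main
      map_add' := fun _ _ => by simp
      map_smul' := fun _ _ => by simp }
  φ_one := P.φ_one
  φ' :=
    { toFun := fun b => P.Φ b.pert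
      map_add' := fun _ _ => by simp
      map_smul' := fun _ _ => by simp }
  φ'_one := P.Φ.map_zero

/-- Cyclic-antimonotone independence of `(A₁, F₁)`. There are `n + 1` elements `f₁, …, fₙ₊₁` of `F₁`
(numbered from `0`) and `n + 2` elements `a₀, …, aₙ₊₁` of `A₁`; the word `a₀ f₁ a₁ f₂ ⋯ fₙ₊₁ aₙ₊₁`
is the element `(a₀ • f₁) (a₁ • f₂) ⋯ (aₙ • fₙ₊₁) <• aₙ₊₁` of `F`. -/
def CyclicAntimonotone (P : NCPSTypeBPrime A F) (A₁ : Subalgebra ℂ A)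
    (F₁ : NonUnitalSubalgebra ℂ F) : Prop :=
  ∀ (n : ℕ) (a : Fin (n + 2) → A) (f : Fin (n + 1) → F),
    (∀ k, a k ∈ A₁) → (∀ k, f k ∈ F₁) →
    P.Φ (prodSucc n (fun k => a k.castSucc • f k) <• a (Fin.last (n + 1))) =
      P.φ (a 0 * a (Fin.last (n + 1))) * (∏ k : Fin n, P.φ (a k.succ.castSucc)) *
        P.Φ (prodSucc n f)

end

end NCPSTypeBPrime

/-! Both conditions are equivalent to a third one, `CenteredWords`: φ'(u f v) = φ(uv) Φ(f), and φ'
kills u f₁ a₁ ⋯ fₘ aₘ f v when m ≥ 1 and the inner aᵢ are centered, with u, v ∈ A₁ arbitrary.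

Cyclic-antimonotone independence gives this because every inner letter contributes a factor φ(aᵢ).
Conversely, splitting an inner letter as a = (a − φ(a)1) + φ(a)1 either leaves a centered letter,
and the word dies, or multiplies two neighbouring elements of F₁ (`CenteredWords.eval`).

For freeness, the centered elements of ℂ1 ⊕ F₁ are those of F₁, and φ of any product with a factor
in F is 0. Hence the mirror product in the definition vanishes as soon as one of its pairs lies in F
(`prod_mirror_eq_zero`), and φ' can be nonzero only on single letters and on words a f a'. The outer
letters u, v of `CenteredWords` need not be centered; linearity reduces them to centered letters or
the unit (`outer_letters_induction`). -/

namespace PertAlg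

/-! ### Embeddings into A ⊕ F and products of words -/

section
variable {A F : Type*} [Ring A] [Algebra ℂ A] [NonUnitalRing F] [Module ℂ F]
  [Module A F] [Module Aᵐᵒᵖ F] [IsBimoduleAlgebra A F]

variable (A F) in
/-- The embedding of the main algebra into `A ⊕ F`. -/
def inl : A →ₐ[ℂ] PertAlg A F where
  toFun a := ⟨a, 0⟩
  map_one' := rfl
  map_mul' _ _ := by ext <;> simp
  map_zero' := rfl
  map_add' _ _ := by ext <;> simp
  commutes' _ := rfl

variable (A F) in
/-- The embedding of the algebra of perturbations into `A ⊕ F`. -/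
def inr : F →ₙₐ[ℂ] PertAlg A F where
  toFun f := ⟨0, f⟩
  map_smul' _ _ := by ext <;> simp
  map_zero' := rfl
  map_add' _ _ := by ext <;> simp
  map_mul' _ _ := by ext <;> simp

@[simp] theorem inl_main (a : A) : (inl A F a).main = a := rfl
@[simp] theorem inl_pert (a : A) : (inl A F a).pert = 0 := rfl
@[simp] theorem inr_main (f : F) : (inr A F f).main = 0 := rfl
@[simp] theorem inr_pert (f : F) : (inr A F f).pert = f := rfl

theorem inr_smul_left (a : A) (f : F) : inr A F (a • f) = inl A F a * inr A F f := by
  ext <;> simp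

theorem inr_smul_right (a : A) (f : F) : inr A F (f <• a) = inr A F f * inl A F a := by
  ext <;> simp

theorem inl_eq_add_smul_one (c : ℂ) (a : A) :
    inl A F a = inl A F (a - algebraMap ℂ A c) + c • 1 := by
  rw [map_sub, AlgHom.commutes, ← Algebra.algebraMap_eq_smul_one, sub_add_cancel]

theorem inr_prodSucc : ∀ (n : ℕ) (x : Fin (n + 1) → F),
    inr A F (prodSucc n x) = (List.ofFn fun k => inr A F (x k)).prod
  | 0, x => by simp [prodSucc]
  | n + 1, x => by
    rw [prodSucc, map_mul, inr_prodSucc n,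
      List.ofFn_succ' fun k => inr A F (x k), List.prod_concat]

/-- The product of the elements `a * f`, for `(a, f)` in a list. -/
def mainPertProd (L : List (A × F)) : PertAlg A F :=
  (L.map fun p => inl A F p.1 * inr A F p.2).prod

/-- The product of the elements `f * a`, for `(f, a)` in a list. -/
def pertMainProd (L : List (F × A)) : PertAlg A F :=
  (L.map fun p => inr A F p.1 * inl A F p.2).prod

@[simp] theorem mainPertProd_nil : mainPertProd ([] : List (A × F)) = 1 := rfl
@[simp] theorem mainPertProd_cons (p : A × F) (L : List (A × F)) :
    mainPertProd (p :: L) = inl A F p.1 * inr A F p.2 * mainPertProd L := by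
  simp [mainPertProd]
@[simp] theorem pertMainProd_nil : pertMainProd ([] : List (F × A)) = 1 := rfl
@[simp] theorem pertMainProd_cons (p : F × A) (L : List (F × A)) :
    pertMainProd (p :: L) = inr A F p.1 * inl A F p.2 * pertMainProd L := by
  simp [pertMainProd]
@[simp] theorem pertMainProd_append (L L' : List (F × A)) :
    pertMainProd (L ++ L') = pertMainProd L * pertMainProd L' := by
  simp [pertMainProd]

/-- The bracketing of a word `f₁ a₁ ⋯ fₘ aₘ f` can be shifted by one letter. -/
theorem exists_pertMainProd_mul_eq (L : List (F × A)) (f : F) :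
    ∃ (g : F) (M : List (A × F)),
      pertMainProd L * inr A F f = inr A F g * mainPertProd M ∧
      M.map Prod.fst = L.map Prod.snd ∧
      ∀ h ∈ g :: M.map Prod.snd, h ∈ f :: L.map Prod.fst := by
  induction L with
  | nil => exact ⟨f, [], by simp, rfl, by simp⟩
  | cons p L ih =>
    obtain ⟨g, M, h₁, h₂, h₃⟩ := ih
    refine ⟨p.1, (p.2, g) :: M, ?_, by simp [h₂], ?_⟩
    · rw [pertMainProd_cons, mainPertProd_cons, mul_assoc, h₁]
      simp only [mul_assoc]
    · intro h hh
      have := h₃ h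
      simp only [List.map_cons, List.mem_cons] at hh this ⊢
      tauto

end

end PertAlg

/-! ### Cyclic-antimonotone independence and centered words -/

namespace NCPSTypeBPrime

open PertAlg

section
variable {A F : Type*} [Ring A] [Algebra ℂ A] [NonUnitalRing F] [Module ℂ F]
  [IsScalarTower ℂ F F] [SMulCommClass ℂ F F] [Module A F] [Module Aᵐᵒᵖ F]
  [IsBimoduleAlgebra A F] (P : NCPSTypeBPrime A F) (A₁ : Subalgebra ℂ A)
  (F₁ : NonUnitalSubalgebra ℂ F)

@[simp] theorem toInfinitesimal_φ_apply (b : PertAlg A F) :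
    P.toInfinitesimal.φ b = P.φ b.main := rfl

@[simp] theorem toInfinitesimal_φ'_inr (f : F) :
    P.toInfinitesimal.φ' (inr A F f) = P.Φ f := rfl

/-- Cyclic-antimonotone independence, in terms of lists of letters. -/
theorem cyclicAntimonotone_iff_list :
    P.CyclicAntimonotone A₁ F₁ ↔
      ∀ (L : List (A × F)) (u v : A) (f : F), u ∈ A₁ → v ∈ A₁ → f ∈ F₁ →
        (∀ p ∈ L, p.1 ∈ A₁ ∧ p.2 ∈ F₁) →
        P.toInfinitesimal.φ' (inl A F u * (inr A F f * mainPertProd L) * inl A F v) =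
          P.φ (u * v) * (L.map fun p => P.φ p.1).prod *
            P.toInfinitesimal.φ' (inr A F f * (L.map fun p => inr A F p.2).prod) := by
  constructor
  · intro h L u v f hu hv hf hL
    -- The letters a₀, …, aₙ₊₁ are u, the first components of `L`, and v.
    have key := h L.length (Fin.cons u (Fin.snoc (fun k => (L.get k).1) v))
      (Fin.cons f fun k => (L.get k).2)
      (by
        refine Fin.cases hu fun k => ?_
        rw [Fin.cons_succ]
        refine Fin.lastCases ?_ (fun k => ?_) k
        · simpa using hv
        · simpa using (hL _ (List.get_mem L k)).1)
      (Fin.cases hf fun k => by simpa using (hL _ (List.get_mem L k)).2)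
    rw [← P.toInfinitesimal_φ'_inr, ← P.toInfinitesimal_φ'_inr, inr_smul_right, inr_prodSucc,
      inr_prodSucc] at key
    simp only [inr_smul_left, List.ofFn_succ, Fin.castSucc_zero, Fin.cons_zero, Fin.cons_succ,
      List.prod_cons, ← Fin.succ_last, Fin.snoc_last, ← Fin.succ_castSucc, Fin.snoc_castSucc] at key
    have e₁ : mainPertProd L =
        (List.ofFn fun k => inl A F (L.get k).1 * inr A F (L.get k).2).prod := by
      rw [mainPertProd]; congr 1
      conv_lhs => rw [← List.ofFn_get L, List.map_ofFn]
      rfl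
    have e₂ : (L.map fun p => P.φ p.1).prod = ∏ k, P.φ (L.get k).1 := by
      rw [← List.prod_ofFn]; congr 1
      conv_lhs => rw [← List.ofFn_get L, List.map_ofFn]
      rfl
    have e₃ : (L.map fun p => inr A F p.2) = List.ofFn fun k => inr A F (L.get k).2 := by
      conv_lhs => rw [← List.ofFn_get L, List.map_ofFn]
      rfl
    rw [e₁, e₂, e₃]
    simpa only [mul_assoc] using key
  · intro h n a f ha hf
    have key := h (List.ofFn fun k : Fin n => (a k.succ.castSucc, f k.succ)) (a 0)
      (a (Fin.last (n + 1))) (f 0) (ha _) (ha _) (hf _) (by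
        intro p hp
        obtain ⟨k, rfl⟩ := (List.mem_ofFn' _ _).1 hp
        exact ⟨ha _, hf _⟩)
    rw [← P.toInfinitesimal_φ'_inr, ← P.toInfinitesimal_φ'_inr, inr_smul_right, inr_prodSucc,
      inr_prodSucc]
    simp only [inr_smul_left, List.ofFn_succ, Fin.castSucc_zero, List.prod_cons]
    simp only [mainPertProd, List.map_ofFn, Function.comp_def, List.prod_ofFn] at key ⊢
    simpa only [mul_assoc] using key

/-- The values of words with centered inner letters from `A₁`. -/
structure CenteredWords : Prop where
  single : ∀ (u v : A) (f : F), u ∈ A₁ → v ∈ A₁ → f ∈ F₁ →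
    P.toInfinitesimal.φ' (inl A F u * inr A F f * inl A F v) = P.φ (u * v) * P.Φ f
  eq_zero : ∀ (L : List (F × A)) (u v : A) (f : F), L ≠ [] → u ∈ A₁ → v ∈ A₁ → f ∈ F₁ →
    (∀ p ∈ L, p.1 ∈ F₁ ∧ p.2 ∈ A₁ ∧ P.φ p.2 = 0) →
    P.toInfinitesimal.φ' (inl A F u * (pertMainProd L * inr A F f) * inl A F v) = 0

variable {P A₁ F₁}

/-- A centered inner letter makes the product of the φ(aᵢ) vanish; rebracketing keeps the same inner
letters in the same order. -/
theorem CyclicAntimonotone.centeredWords (h : P.CyclicAntimonotone A₁ F₁) :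
    P.CenteredWords A₁ F₁ := by
  rw [cyclicAntimonotone_iff_list] at h
  constructor
  · intro u v f hu hv hf
    simpa using h [] u v f hu hv hf (by simp)
  · intro L u v f hne hu hv hf hL
    obtain ⟨g, M, h₁, h₂, h₃⟩ := exists_pertMainProd_mul_eq (A := A) L f
    have hF : ∀ x ∈ g :: M.map Prod.snd, x ∈ F₁ := by
      intro x hx
      rcases List.mem_cons.1 (h₃ x hx) with rfl | hx
      · exact hf
      · obtain ⟨p, hp, rfl⟩ := List.mem_map.1 hx
        exact (hL p hp).1
    have hA : ∀ x ∈ M.map Prod.fst, x ∈ A₁ ∧ P.φ x = 0 := by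
      intro x hx
      rw [h₂] at hx
      obtain ⟨p, hp, rfl⟩ := List.mem_map.1 hx
      exact (hL p hp).2
    rw [h₁, h M u v g hu hv (hF g (by simp)) fun p hp =>
      ⟨(hA _ (List.mem_map_of_mem hp)).1, hF _ (List.mem_cons_of_mem _ (List.mem_map_of_mem hp))⟩]
    have : M ≠ [] := by
      rintro rfl
      exact hne (List.map_eq_nil_iff.1 h₂.symm)
    obtain ⟨p, M, rfl⟩ := List.exists_cons_of_ne_nil this
    rw [List.map_cons, List.prod_cons, (hA p.1 (by simp)).2]
    simp

theorem sub_algebraMap_mem_and_φ_eq_zero {a : A} (ha : a ∈ A₁) :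
    a - algebraMap ℂ A (P.φ a) ∈ A₁ ∧ P.φ (a - algebraMap ℂ A (P.φ a)) = 0 := by
  refine ⟨A₁.sub_mem ha (A₁.algebraMap_mem _), ?_⟩
  rw [map_sub, Algebra.algebraMap_eq_smul_one, map_smul, P.φ_one]
  simp

open Classical in
-- The prefix `K` collects the inner letters already centered, so that the induction on the
-- remaining letters `L` goes through. Once `K` is nonempty the value stays 0; the case `K = []` is
-- the cyclic-antimonotone formula.
theorem CenteredWords.eval (h : P.CenteredWords A₁ F₁) (L : List (A × F)) :
    ∀ (K : List (F × A)) (u v : A) (f : F), u ∈ A₁ → v ∈ A₁ → f ∈ F₁ →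
    (∀ p ∈ L, p.1 ∈ A₁ ∧ p.2 ∈ F₁) →
    (∀ p ∈ K, p.1 ∈ F₁ ∧ p.2 ∈ A₁ ∧ P.φ p.2 = 0) →
    P.toInfinitesimal.φ'
        (inl A F u * (pertMainProd K * inr A F f) * (mainPertProd L * inl A F v)) =
      if K = [] then P.φ (u * v) * (L.map fun p => P.φ p.1).prod *
            P.toInfinitesimal.φ' (inr A F f * (L.map fun p => inr A F p.2).prod) else 0 := by
  induction L with
  | nil =>
    intro K u v f hu hv hf hL hK
    split_ifs with h₀
    · subst h₀
      simpa using h.single u v f hu hv hf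
    · simpa using h.eq_zero K u v f h₀ hu hv hf hK
  | cons p L ih =>
    intro K u v f hu hv hf hL hK
    obtain ⟨a, g⟩ := p
    obtain ⟨ha, hg⟩ := hL (a, g) (by simp)
    have hL' : ∀ p ∈ L, p.1 ∈ A₁ ∧ p.2 ∈ F₁ := fun p hp => hL p (List.mem_cons_of_mem _ hp)
    have hc := sub_algebraMap_mem_and_φ_eq_zero (P := P) ha
    -- The centered part of a extends the prefix and contributes 0; its scalar part lets f and g
    -- merge into one letter, which is `h₂`.
    have h₁ := ih (K ++ [(f, a - algebraMap ℂ A (P.φ a))]) u v g hu hv hg hL' (by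
      intro p hp
      rcases List.mem_append.1 hp with hp | hp
      · exact hK p hp
      · rw [List.mem_singleton.1 hp]
        exact ⟨hf, hc⟩)
    have h₂ := ih K u v (f * g) hu hv (F₁.mul_mem hf hg) hL' hK
    rw [if_neg (by simp)] at h₁
    have e : inl A F u * (pertMainProd K * inr A F f) *
          (mainPertProd ((a, g) :: L) * inl A F v) =
        inl A F u * (pertMainProd (K ++ [(f, a - algebraMap ℂ A (P.φ a))]) * inr A F g) *
          (mainPertProd L * inl A F v) +
        P.φ a • (inl A F u * (pertMainProd K * inr A F (f * g)) *
          (mainPertProd L * inl A F v)) := by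
      rw [mainPertProd_cons, inl_eq_add_smul_one (P.φ a) a, pertMainProd_append, map_mul]
      simp only [pertMainProd_cons, pertMainProd_nil, mul_one, add_mul, mul_add, smul_mul_assoc,
        mul_smul_comm, one_mul, mul_assoc]
    rw [e, map_add, h₁, map_smul, h₂, zero_add]
    split_ifs
    · simp only [List.map_cons, List.prod_cons, map_mul, smul_eq_mul, mul_assoc]
      ring
    · simp

theorem CenteredWords.cyclicAntimonotone (h : P.CenteredWords A₁ F₁) :
    P.CyclicAntimonotone A₁ F₁ := by
  rw [cyclicAntimonotone_iff_list]
  intro L u v f hu hv hf hL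
  have := h.eval L [] u v f hu hv hf hL (by simp)
  rw [if_pos rfl] at this
  rw [← this]
  simp [mul_assoc]

end
end NCPSTypeBPrime

/-! ### Alternating words with labelled letters -/

namespace PertAlg

section
variable {A F : Type*} [Ring A] [Algebra ℂ A] [NonUnitalRing F] [Module ℂ F]
  [Module A F] [Module Aᵐᵒᵖ F] [IsBimoduleAlgebra A F]

/-- The alternating word `f₁ a₁ ⋯ fₘ aₘ` followed by the word `t`, each letter labelled by the index
of its subalgebra (`0` for `A`, `1` for `F`). -/
def alternatingWord (L : List (F × A)) (t : List (Fin 2 × PertAlg A F)) :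
    List (Fin 2 × PertAlg A F) :=
  L.foldr (fun p l => (1, inr A F p.1) :: (0, inl A F p.2) :: l) t

@[simp] theorem alternatingWord_nil (t : List (Fin 2 × PertAlg A F)) :
    alternatingWord [] t = t := rfl

@[simp] theorem alternatingWord_cons (p : F × A) (L : List (F × A))
    (t : List (Fin 2 × PertAlg A F)) :
    alternatingWord (p :: L) t = (1, inr A F p.1) :: (0, inl A F p.2) :: alternatingWord L t := rfl

theorem prod_alternatingWord (L : List (F × A)) (t : List (Fin 2 × PertAlg A F)) :
    ((alternatingWord L t).map Prod.snd).prod = pertMainProd L * (t.map Prod.snd).prod := by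
  induction L with
  | nil => simp
  | cons p L ih => simp [ih, mul_assoc]

theorem length_alternatingWord (L : List (F × A)) (t : List (Fin 2 × PertAlg A F)) :
    (alternatingWord L t).length = 2 * L.length + t.length := by
  induction L with
  | nil => simp
  | cons p L ih => simp [ih]; ring

theorem isChain_cons_alternatingWord (L : List (F × A)) (x y : PertAlg A F)
    (t : List (Fin 2 × PertAlg A F))
    (ht : ((1, y) :: t).IsChain fun p q => p.1 ≠ q.1) :
    ((0, x) :: alternatingWord L ((1, y) :: t)).IsChain fun p q => p.1 ≠ q.1 := by
  induction L generalizing x with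
  | nil => exact List.isChain_cons_cons.2 ⟨by simp, ht⟩
  | cons p L ih =>
    rw [alternatingWord_cons, List.isChain_cons_cons, List.isChain_cons_cons]
    exact ⟨by simp, by simp, ih _⟩

theorem mem_alternatingWord {L : List (F × A)} {t : List (Fin 2 × PertAlg A F)}
    {Q : Fin 2 × PertAlg A F → Prop}
    (hL : ∀ p ∈ L, Q (1, inr A F p.1) ∧ Q (0, inl A F p.2)) (ht : ∀ x ∈ t, Q x) :
    ∀ x ∈ alternatingWord L t, Q x := by
  induction L with
  | nil => exact ht
  | cons p L ih =>
    have h := ih fun q hq => hL q (List.mem_cons_of_mem _ hq)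
    have hp := hL p (by simp)
    simp only [alternatingWord_cons, List.mem_cons, forall_eq_or_imp]
    exact ⟨hp.1, hp.2, h⟩

end
end PertAlg

/-! ### Centered letters; from infinitesimal freeness to centered words -/

namespace NCPSTypeBPrime

open PertAlg

section
variable {A F : Type*} [Ring A] [Algebra ℂ A] [NonUnitalRing F] [Module ℂ F]
  [IsScalarTower ℂ F F] [SMulCommClass ℂ F F] [Module A F] [Module Aᵐᵒᵖ F]
  [IsBimoduleAlgebra A F] (P : NCPSTypeBPrime A F) (A₁ : Subalgebra ℂ A)
  (F₁ : NonUnitalSubalgebra ℂ F)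

/-- A labelled letter that is a centered element of the subalgebra with its label. -/
def IsCenteredLetter (x : Fin 2 × PertAlg A F) : Prop :=
  x.2 ∈ (![ofMain A₁, ofPert F₁] : Fin 2 → Subalgebra ℂ (PertAlg A F)) x.1 ∧
    P.toInfinitesimal.φ x.2 = 0

variable {P A₁ F₁}

theorem isCenteredLetter_zero_iff {b : PertAlg A F} :
    P.IsCenteredLetter A₁ F₁ (0, b) ↔ ∃ a ∈ A₁, P.φ a = 0 ∧ b = inl A F a := by
  constructor
  · rintro ⟨h, h'⟩
    exact ⟨b.main, h.1, h', PertAlg.ext rfl h.2⟩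
  · rintro ⟨a, ha, h, rfl⟩
    exact ⟨⟨ha, rfl⟩, h⟩

/-- Since φ(1) = 1, the scalar part of a centered element of ℂ1 ⊕ F₁ is 0. -/
theorem isCenteredLetter_one_iff {b : PertAlg A F} :
    P.IsCenteredLetter A₁ F₁ (1, b) ↔ ∃ f ∈ F₁, b = inr A F f := by
  constructor
  · rintro ⟨⟨⟨c, hc⟩, h⟩, h'⟩
    refine ⟨b.pert, h, PertAlg.ext ?_ rfl⟩
    rw [toInfinitesimal_φ_apply] at h'
    simp only at h'
    rw [hc, Algebra.algebraMap_eq_smul_one, map_smul, P.φ_one, smul_eq_mul, mul_one] at h'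
    rw [hc, h', map_zero, inr_main]
  · rintro ⟨f, hf, rfl⟩
    exact ⟨⟨⟨0, by simp⟩, hf⟩, by simp⟩

theorem isCenteredLetter_inl {a : A} (ha : a ∈ A₁) (h : P.φ a = 0) :
    P.IsCenteredLetter A₁ F₁ (0, inl A F a) :=
  isCenteredLetter_zero_iff.2 ⟨a, ha, h, rfl⟩

theorem isCenteredLetter_inr {f : F} (hf : f ∈ F₁) :
    P.IsCenteredLetter A₁ F₁ (1, inr A F f) :=
  isCenteredLetter_one_iff.2 ⟨f, hf, rfl⟩

theorem IsCenteredLetter.main_eq_zero {i : Fin 2} {b : PertAlg A F}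
    (h : P.IsCenteredLetter A₁ F₁ (i, b)) (hi : i = 1) : b.main = 0 := by
  subst hi
  obtain ⟨f, -, rfl⟩ := isCenteredLetter_one_iff.1 h
  rfl

/-- In a long alternating word, the product of the values of mirror pairs vanishes. -/
theorem prod_mirror_eq_zero {n : ℕ} (hn : n / 2 ≤ n) {i : Fin n → Fin 2} {b : Fin n → PertAlg A F}
    (hi : ∀ k l : Fin n, (k : ℕ) + 1 = l → i k ≠ i l)
    (hb : ∀ k, P.IsCenteredLetter A₁ F₁ (i k, b k))
    (h : 4 ≤ n ∨ 2 ≤ n ∧ ∀ hn : 0 < n, i ⟨0, hn⟩ = 1) :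
    ∏ k : Fin (n / 2), P.toInfinitesimal.φ (b (k.castLE hn) * b (k.castLE hn).rev) = 0 := by
  -- One of the first two letters lies in F. The second one heads a mirror pair only when n ≥ 4; for
  -- smaller n the first must be the one in F.
  have key : ∃ k : Fin (n / 2), i (k.castLE hn) = 1 := by
    by_cases h0 : i ⟨0, by omega⟩ = 1
    · exact ⟨⟨0, by omega⟩, h0⟩
    · have h4 : 4 ≤ n := by
        rcases h with h | h
        · exact h
        · exact absurd (h.2 _) h0
      refine ⟨⟨1, by omega⟩, ?_⟩
      have := hi ⟨0, by omega⟩ ⟨1, by omega⟩ rfl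
      simp only [Fin.castLE_mk]
      omega
  obtain ⟨k, hk⟩ := key
  refine Finset.prod_eq_zero (Finset.mem_univ k) ?_
  rw [toInfinitesimal_φ_apply, mul_main, (hb _).main_eq_zero hk, zero_mul, map_zero]

/-- Among nonempty words, `hlen` excludes exactly the single letters and the words of length 3
starting in A. Words of length 2 are covered by the even case of freeness. -/
theorem _root_.InfinitesimallyFree.φ'_prod_eq_zero
    (h : InfinitesimallyFree P.toInfinitesimal ![ofMain A₁, ofPert F₁])
    (l : List (Fin 2 × PertAlg A F)) (hl : l.IsChain fun p q => p.1 ≠ q.1)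
    (hc : ∀ x ∈ l, P.IsCenteredLetter A₁ F₁ x)
    (hlen : 4 ≤ l.length ∨ l.length = 2 ∨ 2 ≤ l.length ∧ ∀ hn : 0 < l.length, l[0].1 = 1) :
    P.toInfinitesimal.φ' (l.map Prod.snd).prod = 0 := by
  have hi : ∀ k m : Fin l.length, (k : ℕ) + 1 = m → (l.get k).1 ≠ (l.get m).1 := by
    rintro ⟨k, hk⟩ ⟨m, hm⟩ hkm
    simp only at hkm
    subst hkm
    exact List.isChain_iff_getElem.1 hl k hm
  have hb : ∀ k, P.IsCenteredLetter A₁ F₁ (l.get k) := fun k => hc _ (List.get_mem l k)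
  have e : l.map Prod.snd = List.ofFn fun k => (l.get k).2 := by
    conv_lhs => rw [← List.ofFn_get l, List.map_ofFn]
    rfl
  obtain ⟨-, h₁, h₂⟩ := h l.length (by omega) (fun k => (l.get k).1) (fun k => (l.get k).2) hi hb
  rw [e]
  by_cases ho : Odd l.length ∧ ∀ k : Fin l.length, (l.get k).1 = (l.get k.rev).1
  · rw [h₁ ho, prod_mirror_eq_zero (P := P) (A₁ := A₁) (F₁ := F₁)
      (Nat.div_le_self _ 2) hi hb, zero_mul]
    rcases hlen with h | h | h
    · exact Or.inl h
    · exact absurd ho.1 (by rw [h]; decide)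
    · exact Or.inr h
  · exact h₂ ho

theorem _root_.InfinitesimallyFree.φ'_mul_mul
    (h : InfinitesimallyFree P.toInfinitesimal ![ofMain A₁, ofPert F₁]) {u v : A} {f : F}
    (hu : u ∈ A₁) (hv : v ∈ A₁) (hf : f ∈ F₁) (hu₀ : P.φ u = 0) (hv₀ : P.φ v = 0) :
    P.toInfinitesimal.φ' (inl A F u * inr A F f * inl A F v) = P.φ (u * v) * P.Φ f := by
  obtain ⟨-, h₁, -⟩ := h 3 (by norm_num) ![0, 1, 0] ![inl A F u, inr A F f, inl A F v]
    (by
      intro k l hkl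
      fin_cases k <;> fin_cases l <;> simp at hkl ⊢)
    (by
      intro k
      fin_cases k
      · exact isCenteredLetter_inl hu hu₀
      · exact isCenteredLetter_inr hf
      · exact isCenteredLetter_inl hv hv₀)
  have := h₁ ⟨by decide, by decide⟩
  simpa [List.ofFn_succ, mul_assoc, Fin.rev] using this

/-- A₁ is spanned by 1 and its centered elements. -/
theorem linear_eq_of_eq_on_centered (g g' : A →ₗ[ℂ] ℂ)
    (h : ∀ a ∈ A₁, P.φ a = 0 → g a = g' a) (h₁ : g 1 = g' 1) {a : A} (ha : a ∈ A₁) :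
    g a = g' a := by
  have hc := sub_algebraMap_mem_and_φ_eq_zero (P := P) ha
  have := h _ hc.1 hc.2
  rwa [map_sub, map_sub, Algebra.algebraMap_eq_smul_one, map_smul, map_smul, h₁,
    sub_left_inj] at this

/-- An identity that is linear in both outer letters holds if it holds when each of them is centered
or the unit. -/
theorem outer_letters_induction (X : PertAlg A F) (c : ℂ)
    (h : ∀ u v : A, u ∈ A₁ → v ∈ A₁ → (P.φ u = 0 ∨ u = 1) → (P.φ v = 0 ∨ v = 1) →
      P.toInfinitesimal.φ' (inl A F u * X * inl A F v) = P.φ (u * v) * c)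
    {u v : A} (hu : u ∈ A₁) (hv : v ∈ A₁) :
    P.toInfinitesimal.φ' (inl A F u * X * inl A F v) = P.φ (u * v) * c := by
  have step : ∀ u ∈ A₁, (P.φ u = 0 ∨ u = 1) →
      P.toInfinitesimal.φ' (inl A F u * X * inl A F v) = P.φ (u * v) * c := by
    intro u hu hu'
    have e := linear_eq_of_eq_on_centered (P := P) (A₁ := A₁)
      (P.toInfinitesimal.φ' ∘ₗ LinearMap.mulLeft ℂ (inl A F u * X) ∘ₗ (inl A F).toLinearMap)
      (c • (P.φ ∘ₗ LinearMap.mulLeft ℂ u))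
      (fun a ha ha' => by simpa [mul_comm, mul_assoc] using h u a hu ha hu' (Or.inl ha'))
      (by simpa [mul_comm] using h u 1 hu A₁.one_mem hu' (Or.inr rfl)) hv
    simpa [mul_comm, mul_assoc] using e
  have e := linear_eq_of_eq_on_centered (P := P) (A₁ := A₁)
    (P.toInfinitesimal.φ' ∘ₗ LinearMap.mulRight ℂ (X * inl A F v) ∘ₗ (inl A F).toLinearMap)
    (c • (P.φ ∘ₗ LinearMap.mulRight ℂ v))
    (fun a ha ha' => by simpa [mul_comm, mul_assoc] using step a ha (Or.inl ha'))
    (by simpa [mul_comm, mul_assoc] using step 1 A₁.one_mem (Or.inr rfl)) hu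
  simpa [mul_comm, mul_assoc] using e

/-- Once each outer letter is centered or the unit, units can be dropped, and what remains is an
alternating word of centered letters. -/
theorem _root_.InfinitesimallyFree.centeredWords
    (h : InfinitesimallyFree P.toInfinitesimal ![ofMain A₁, ofPert F₁]) :
    P.CenteredWords A₁ F₁ := by
  constructor
  · intro u v f hu hv hf
    refine outer_letters_induction (P := P) (A₁ := A₁) _ _ ?_ hu hv
    rintro u v hu hv (hu' | rfl) (hv' | rfl)
    · exact h.φ'_mul_mul hu hv hf hu' hv'
    · have := h.φ'_prod_eq_zero [(0, inl A F u), (1, inr A F f)] (by simp)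
        (by simpa using ⟨isCenteredLetter_inl hu hu', isCenteredLetter_inr hf⟩) (by simp)
      simpa [hu'] using this
    · have := h.φ'_prod_eq_zero [(1, inr A F f), (0, inl A F v)] (by simp)
        (by simpa using ⟨isCenteredLetter_inr hf, isCenteredLetter_inl hv hv'⟩) (by simp)
      simpa [hv'] using this
    · simp [P.φ_one]
  · intro L u v f hne hu hv hf hL
    obtain ⟨p, L, rfl⟩ := List.exists_cons_of_ne_nil hne
    have hL' : ∀ q ∈ p :: L, P.IsCenteredLetter A₁ F₁ (1, inr A F q.1) ∧
        P.IsCenteredLetter A₁ F₁ (0, inl A F q.2) := fun q hq =>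
      ⟨isCenteredLetter_inr (hL q hq).1, isCenteredLetter_inl (hL q hq).2.1 (hL q hq).2.2⟩
    -- Here `t` is what follows f: the letter v, or nothing when v = 1. With a centered u the word
    -- has length at least 4; with u = 1 it starts in F and may have length 3.
    have zero : ∀ u ∈ A₁, (P.φ u = 0 ∨ u = 1) → ∀ t : List (Fin 2 × PertAlg A F),
        ((1, inr A F f) :: t).IsChain (fun p q => p.1 ≠ q.1) →
        (∀ x ∈ t, P.IsCenteredLetter A₁ F₁ x) →
        P.toInfinitesimal.φ' (inl A F u * (pertMainProd (p :: L) *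
          (((1, inr A F f) :: t).map Prod.snd).prod)) = 0 := by
      intro u hu hu' t ht htc
      have hchain := isChain_cons_alternatingWord (p :: L) (inl A F u) (inr A F f) t ht
      have hmem : ∀ x ∈ alternatingWord (p :: L) ((1, inr A F f) :: t),
          P.IsCenteredLetter A₁ F₁ x := mem_alternatingWord hL' (by
        simp only [List.mem_cons, forall_eq_or_imp]
        exact ⟨isCenteredLetter_inr hf, htc⟩)
      have hlen := length_alternatingWord (p :: L) ((1, inr A F f) :: t)
      simp only [List.length_cons] at hlen
      rw [← prod_alternatingWord]
      rcases hu' with hu' | rfl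
      · have := h.φ'_prod_eq_zero _ hchain
          (by
            rw [List.forall_mem_cons]
            exact ⟨isCenteredLetter_inl hu hu', hmem⟩)
          (by simp only [List.length_cons]; omega)
        simpa using this
      · have := h.φ'_prod_eq_zero _ hchain.tail hmem
          (Or.inr (Or.inr ⟨by rw [List.tail_cons]; omega, fun _ => rfl⟩))
        simpa using this
    have := outer_letters_induction (P := P) (A₁ := A₁)
      (pertMainProd (p :: L) * inr A F f) 0 (by
        rintro u v hu hv hu' (hv' | rfl)
        · simpa [mul_assoc] using zero u hu hu' [(0, inl A F v)] (by simp)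
            (by simpa using isCenteredLetter_inl hv hv')
        · simpa [mul_assoc] using zero u hu hu' [] (by simp) (by simp)) hu hv
    simpa using this

/-! ### From centered words to infinitesimal freeness -/

/-- An alternating word of centered letters that starts in `F` has the form `f₁ a₁ ⋯ fₘ aₘ f v`. -/
theorem exists_eq_pertMainProd : ∀ (l : List (Fin 2 × PertAlg A F)) (b : PertAlg A F),
    ((1, b) :: l).IsChain (fun p q => p.1 ≠ q.1) →
    (∀ x ∈ (1, b) :: l, P.IsCenteredLetter A₁ F₁ x) →
    ∃ (L : List (F × A)) (f : F) (v : A), f ∈ F₁ ∧ v ∈ A₁ ∧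
      (∀ p ∈ L, p.1 ∈ F₁ ∧ p.2 ∈ A₁ ∧ P.φ p.2 = 0) ∧ l.length ≤ 2 * L.length + 1 ∧
      (((1, b) :: l).map Prod.snd).prod = pertMainProd L * inr A F f * inl A F v
  | [], b, _, hc => by
    obtain ⟨f, hf, rfl⟩ := isCenteredLetter_one_iff.1 (hc (1, b) (by simp))
    exact ⟨[], f, 1, hf, A₁.one_mem, by simp, by simp, by simp⟩
  | [(j, b')], b, hl, hc => by
    have hj : j = 0 := by
      have := (List.isChain_cons_cons.1 hl).1
      simp only at this
      omega
    subst hj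
    obtain ⟨f, hf, rfl⟩ := isCenteredLetter_one_iff.1 (hc (1, b) (by simp))
    obtain ⟨a, ha, -, rfl⟩ := isCenteredLetter_zero_iff.1 (hc (0, b') (by simp))
    exact ⟨[], f, a, hf, ha, by simp, by simp, by simp⟩
  | (j, b') :: (m, b'') :: l, b, hl, hc => by
    have hl' := List.isChain_cons_cons.1 hl
    have hj : j = 0 := by
      have := hl'.1
      simp only at this
      omega
    have hm : m = 1 := by
      have := (List.isChain_cons_cons.1 hl'.2).1
      simp only at this
      omega
    subst hj hm
    obtain ⟨f, hf, rfl⟩ := isCenteredLetter_one_iff.1 (hc (1, b) (by simp))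
    obtain ⟨a, ha, ha', rfl⟩ := isCenteredLetter_zero_iff.1 (hc (0, b') (by simp))
    obtain ⟨L, g, v, hg, hv, hL, hlen, e⟩ := exists_eq_pertMainProd l b''
      (List.isChain_cons_cons.1 hl'.2).2
      fun x hx => hc x (List.mem_cons_of_mem _ (List.mem_cons_of_mem _ hx))
    refine ⟨(f, a) :: L, g, v, hg, hv, ?_, ?_, ?_⟩
    · rw [List.forall_mem_cons]
      exact ⟨⟨hf, ha, ha'⟩, hL⟩
    · simp only [List.length_cons]
      omega
    · rw [List.map_cons, List.prod_cons, List.map_cons, List.prod_cons, e, pertMainProd_cons]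
      simp only [mul_assoc]

/-- The length bound forces at least one centered inner letter. The factor u absorbs a possible
leading letter from A. -/
theorem CenteredWords.φ'_prod_eq_zero (h : P.CenteredWords A₁ F₁) {u : A} (hu : u ∈ A₁)
    {l : List (Fin 2 × PertAlg A F)} {b : PertAlg A F}
    (hl : ((1, b) :: l).IsChain fun p q => p.1 ≠ q.1)
    (hc : ∀ x ∈ (1, b) :: l, P.IsCenteredLetter A₁ F₁ x) (hlen : 2 ≤ l.length) :
    P.toInfinitesimal.φ' (inl A F u * (((1, b) :: l).map Prod.snd).prod) = 0 := by
  obtain ⟨L, f, v, hf, hv, hL, hlen', e⟩ := exists_eq_pertMainProd l b hl hc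
  rw [e, ← mul_assoc]
  refine h.eq_zero L u v f ?_ hu hv hf hL
  rintro rfl
  simp at hlen'
  omega

/-- The functional `φ'` vanishes on centered alternating words other than single letters and words
`a f a'`. -/
theorem CenteredWords.φ'_prod_alternating_eq_zero (h : P.CenteredWords A₁ F₁)
    (l : List (Fin 2 × PertAlg A F)) (hl : l.IsChain fun p q => p.1 ≠ q.1)
    (hc : ∀ x ∈ l, P.IsCenteredLetter A₁ F₁ x)
    (hlen : 4 ≤ l.length ∨ l.length = 2 ∨ 2 ≤ l.length ∧ ∀ hn : 0 < l.length, l[0].1 = 1) :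
    P.toInfinitesimal.φ' (l.map Prod.snd).prod = 0 := by
  match l, hl, hc, hlen with
  | [], _, _, hlen => simp at hlen
  | [_], _, _, hlen => simp at hlen
  | [(i, b), (j, b')], hl, hc, _ =>
    have hij : i ≠ j := by simpa using hl
    have h₁ := hc (i, b) (by simp)
    have h₂ := hc (j, b') (by simp)
    obtain ⟨rfl, rfl⟩ | ⟨rfl, rfl⟩ : (i = 0 ∧ j = 1) ∨ (i = 1 ∧ j = 0) := by omega
    · obtain ⟨a, ha, ha', rfl⟩ := isCenteredLetter_zero_iff.1 h₁
      obtain ⟨f, hf, rfl⟩ := isCenteredLetter_one_iff.1 h₂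
      simpa [ha'] using h.single a 1 f ha A₁.one_mem hf
    · obtain ⟨f, hf, rfl⟩ := isCenteredLetter_one_iff.1 h₁
      obtain ⟨a, ha, ha', rfl⟩ := isCenteredLetter_zero_iff.1 h₂
      simpa [ha'] using h.single 1 a f A₁.one_mem ha hf
  | (i, b) :: (j, b') :: x :: l, hl, hc, hlen =>
    obtain rfl | rfl : i = 1 ∨ i = 0 := by omega
    · simpa using h.φ'_prod_eq_zero A₁.one_mem hl hc (by simp)
    · have hj : j = 1 := by
        have := (List.isChain_cons_cons.1 hl).1
        simp only at this
        omega
      subst hj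
      obtain ⟨a, ha, -, rfl⟩ := isCenteredLetter_zero_iff.1 (hc (0, b) (by simp))
      rw [List.map_cons, List.prod_cons]
      refine h.φ'_prod_eq_zero ha hl.tail (fun x hx => hc x (List.mem_cons_of_mem _ hx)) ?_
      simp at hlen ⊢
      omega

theorem CenteredWords.infinitesimallyFree (h : P.CenteredWords A₁ F₁) :
    InfinitesimallyFree P.toInfinitesimal ![ofMain A₁, ofPert F₁] := by
  intro n hn (i : Fin n → Fin 2) b hi hb
  replace hb : ∀ k, P.IsCenteredLetter A₁ F₁ (i k, b k) := hb
  have hchain : (List.ofFn fun k => (i k, b k)).IsChain fun p q => p.1 ≠ q.1 := by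
    rw [List.isChain_ofFn]
    intro k hk
    exact hi _ _ rfl
  have hmem : ∀ x ∈ List.ofFn fun k => (i k, b k), P.IsCenteredLetter A₁ F₁ x := by
    rw [List.forall_mem_ofFn_iff]
    exact hb
  have e : (List.ofFn fun k => (i k, b k)).map Prod.snd = List.ofFn b := by
    rw [List.map_ofFn]; rfl
  have zero := h.φ'_prod_alternating_eq_zero _ hchain hmem
  rw [e] at zero
  simp only [List.length_ofFn, List.getElem_ofFn] at zero
  refine ⟨?_, ?_⟩
  · obtain rfl | h1 : n = 1 ∨ 2 ≤ n := by omega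
    · simpa using (hb 0).2
    -- An alternating word of length at least 2 contains a letter from F, so its main term is 0.
    · have key : ∃ k, i k = 1 := by
        have := hi ⟨0, by omega⟩ ⟨1, by omega⟩ rfl
        by_cases h0 : i ⟨0, by omega⟩ = 1
        · exact ⟨_, h0⟩
        · exact ⟨⟨1, by omega⟩, by omega⟩
      obtain ⟨k, hk⟩ := key
      have hz : ∀ l : List (PertAlg A F), b k ∈ l → l.prod.main = 0 := by
        intro l
        induction l with
        | nil => simp
        | cons x l ih =>
          intro hx
          rw [List.prod_cons, mul_main]
          rcases List.mem_cons.1 hx with rfl | hx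
          · rw [(hb k).main_eq_zero hk, zero_mul]
          · rw [ih hx, mul_zero]
      rw [toInfinitesimal_φ_apply, hz _ ((List.mem_ofFn' _ _).2 ⟨k, rfl⟩), map_zero]
  · by_cases hz : 4 ≤ n ∨ n = 2 ∨ 2 ≤ n ∧ ∀ hn : 0 < n, i ⟨0, hn⟩ = 1
    · rw [zero hz]
      refine ⟨fun ho => ?_, fun _ => rfl⟩
      rw [prod_mirror_eq_zero (P := P) (A₁ := A₁) (F₁ := F₁) (Nat.div_le_self _ 2) hi hb, zero_mul]
      rcases hz with h | rfl | h
      · exact Or.inl h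
      · exact absurd ho.1 (by decide)
      · exact Or.inr h
    -- Only n = 1 and the words a f a' remain. Both are palindromic, so the last clause of freeness
    -- is void.
    · have hn₄ : ¬ 4 ≤ n := fun h => hz (Or.inl h)
      have hn₂ : n ≠ 2 := fun h => hz (Or.inr (Or.inl h))
      obtain rfl | rfl : n = 1 ∨ n = 3 := by clear hz zero; omega
      · refine ⟨fun _ => by simp, fun ho => absurd ⟨by decide, fun k => ?_⟩ ho⟩
        exact congrArg i (Subsingleton.elim _ _)
      · have h0 : i 0 = 0 := by
          by_contra hne
          refine hz (Or.inr (Or.inr ⟨by norm_num, fun _ => ?_⟩))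
          change i 0 = 1
          omega
        have h1 : i 1 = 1 := by
          have := hi 0 1 rfl
          omega
        have h2 : i 2 = 0 := by
          have := hi 1 2 rfl
          omega
        refine ⟨fun _ => ?_, fun ho => absurd ⟨by decide, fun k => ?_⟩ ho⟩
        · obtain ⟨u, hu, -, eu⟩ := isCenteredLetter_zero_iff.1 (h0 ▸ hb 0)
          obtain ⟨f, hf, ef⟩ := isCenteredLetter_one_iff.1 (h1 ▸ hb 1)
          obtain ⟨v, hv, -, ev⟩ := isCenteredLetter_zero_iff.1 (h2 ▸ hb 2)
          have := h.single u v f hu hv hf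
          simpa [List.ofFn_succ, mul_assoc, Fin.rev, eu, ef, ev] using this
        · fin_cases k
          · exact h0.trans h2.symm
          · rfl
          · exact h2.trans h0.symm

end
end NCPSTypeBPrime

theorem proposition3p1 {A F : Type*} [Ring A] [Algebra ℂ A] [NonUnitalRing F] [Module ℂ F]
    [IsScalarTower ℂ F F] [SMulCommClass ℂ F F] [Module A F] [Module Aᵐᵒᵖ F]
    [IsBimoduleAlgebra A F] (P : NCPSTypeBPrime A F) (A₁ : Subalgebra ℂ A)
    (F₁ : NonUnitalSubalgebra ℂ F) :
    P.CyclicAntimonotone A₁ F₁ ↔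
      InfinitesimallyFree P.toInfinitesimal ![PertAlg.ofMain A₁, PertAlg.ofPert F₁] :=
  ⟨fun h => h.centeredWords.infinitesimallyFree, fun h => h.centeredWords.cyclicAntimonotone⟩
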